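/- Let $n\ge 0$ and $\Omega=\begin{bmatrix}0&I_n\\-I_n&0\end{bmatrix}$. A *phase matrix* is a complex symmetric $n\times n$ matrix $\Phi$ with $\mathrm{Im}(\Phi)\succ0$. An *$n$-qumode Gaussian state* with phase matrix $\Phi$ and displacement $(s,t)\in\mathbb R^n\times\mathbb R^n$ is a function in $L^2(\mathbb R^n)$ of the form $$\varphi(x)=e^{i\alpha}e^{is^{T}x}\Big(\tfrac{\det \mathrm{Im}(\Phi)}{\pi^n}\Big)^{1/4}\exp\!\big(\tfrac i2(x-t)^{T}\Phi(x-t)\big),\qquad \alpha\in[0,2\pi),$$ and its *Wigner transform* is $$W_\varphi(q,p)=\frac1{\pi^n}\int_{\mathbb R^n}\overline{\varphi(q+\xi)}\,\varphi(q-\xi)\,e^{2i\xi^{T}p}\,d\xi ,\qquad (q,p)\in\mathbb R^{2n}.$$ Let $\mathcal N(S,m)$ denote the Gaussian distribution with covariance matrix $S$ and mean $m$; if $S\succ0$, its density on $\mathbb R^{2n}$ is $u\mapsto \exp(-\frac12(u-m)^{T}S^{-1}(u-m))/\sqrt{(2\pi)^{2n}\det S}$. Call a real symmetric $2n\times2n$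 matrix $\Delta$ *pure* if $\det\Delta=1$ and $\Delta+i\Omega\succeq0$. (1) The function $\varphi$ above is square integrable for every phase matrix $\Phi$, all $s,t\in\mathbb R^n$ and all $\alpha\in\mathbb R$. If $\varphi$ is a Gaussian state with phase matrix $\Phi$ and displacement $(s,t)$, put $$\Sigma=\begin{bmatrix}\mathrm{Im}(\Phi)+\mathrm{Re}(\Phi)\mathrm{Im}(\Phi)^{-1}\mathrm{Re}(\Phi)&-\mathrm{Re}(\Phi)\mathrm{Im}(\Phi)^{-1}\\-\mathrm{Im}(\Phi)^{-1}\mathrm{Re}(\Phi)&\mathrm{Im}(\Phi)^{-1}\end{bmatrix},\qquad m=\begin{bmatrix}t\\s\end{bmatrix}.$$ Then $\Sigma$ is pure, and for all $u=\begin{bmatrix}q\\p\end{bmatrix}\in\mathbb R^{2n}$ $$W_\varphi(u)=\pi^{-n}\exp\!\big(-(u-m)^{T}\Sigma\,(u-m)\big);$$ that is, $W_\varphi$ is the density of $\mathcal N(\tfrac12\Sigma^{-1},m)$. Moreover, the image of this distribution under the linear map $\sqrt2\,\Omega:(q,p)\mapsto\sqrt2\,(p,-q)$ is $\mathcal N\big(\Sigma,\sqrt2\,(s,-t)\big)$.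 (2) Conversely, let $\Delta=\begin{bmatrix}A&B\\B^{T}&C\end{bmatrix}$ with $A,C$ real symmetric and $B$ real $n\times n$, and suppose that $\Delta$ is pure. Then $C$ is invertible, $\Phi=-BC^{-1}+iC^{-1}$ is a phase matrix, and its matrix $\Sigma$ equals $\Delta$. For all $s,t\in\mathbb R^n$, a Gaussian state has as Wigner transform the density of $\mathcal N\big(\tfrac12\Delta^{-1},(t,s)\big)$ if and only if it has phase matrix $\Phi$ and displacement $(s,t)$. (3) Distinct pairs $(\Delta,m)$, with $\Delta$ pure and $m\in\mathbb R^{2n}$, give distinct distributions $\mathcal N(\frac12\Delta^{-1},m)$, and $\varphi\mapsto W_\varphi$ induces a bijection from the set of Gaussian states modulo global phase ($\varphi\sim e^{i\theta}\varphi$, $\theta\in\mathbb R$) onto the set of densities of the distributions $\mathcal N(\frac12\Delta^{-1},m)$ with $\Delta$ pure and $m\in\mathbb R^{2n}$. -/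

import Mathlib

open MeasureTheory ProbabilityTheory
open scoped ComplexOrder Matrix

noncomputable section

namespace GaussWigner

/-- Configuration space `ℝⁿ`. -/
abbrev Config (n : ℕ) : Type := EuclideanSpace ℝ (Fin n)

/-- Phase space `ℝ²ⁿ`; a point is a column `[q; p]` with blocks `q` (left summand) and `p`
(right summand). -/
abbrev Phase (n : ℕ) : Type := EuclideanSpace ℝ (Fin n ⊕ Fin n)

/-- The column `[q; p]`. -/
def column {n : ℕ} (q p : Config n) : Phase n :=
  WithLp.toLp 2 (Sum.elim (fun i => q i) (fun i => p i))

/-- The upper block of a point of phase space. -/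
def upper {n : ℕ} (u : Phase n) : Config n := WithLp.toLp 2 (fun i => u (Sum.inl i))

/-- The lower block of a point of phase space. -/
def lower {n : ℕ} (u : Phase n) : Config n := WithLp.toLp 2 (fun i => u (Sum.inr i))

/-- Entrywise real part. -/
def reMat {n : ℕ} (Φ : Matrix (Fin n) (Fin n) ℂ) : Matrix (Fin n) (Fin n) ℝ := Φ.map Complex.re

/-- Entrywise imaginary part. -/
def imMat {n : ℕ} (Φ : Matrix (Fin n) (Fin n) ℂ) : Matrix (Fin n) (Fin n) ℝ := Φ.map Complex.im

/-- A phase matrix: complex symmetric with positive definite imaginary part. -/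
def IsPhaseMatrix {n : ℕ} (Φ : Matrix (Fin n) (Fin n) ℂ) : Prop :=
  Φ.IsSymm ∧ (imMat Φ).PosDef

/-- The wave function
`exp(iα) exp(i sᵀx) (det(Im Φ)/πⁿ)^(1/4) exp(i (x - t)ᵀ Φ (x - t) / 2)`. -/
def gaussianWave {n : ℕ} (α : ℝ) (s t : Config n) (Φ : Matrix (Fin n) (Fin n) ℂ)
    (x : Config n) : ℂ :=
  Complex.exp (Complex.I * α) * Complex.exp (Complex.I * ((∑ i, s i * x i : ℝ) : ℂ)) *
    ((((imMat Φ).det / Real.pi ^ n) ^ (1 / 4 : ℝ) : ℝ) : ℂ) *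
    Complex.exp (Complex.I *
      ((fun i => ((x i - t i : ℝ) : ℂ)) ⬝ᵥ Φ *ᵥ (fun i => ((x i - t i : ℝ) : ℂ))) / 2)

/-- `L²(ℝⁿ)`. -/
abbrev L2 (n : ℕ) : Type := Lp ℂ 2 (volume : Measure (Config n))

/-- `ψ` is a Gaussian state with phase matrix `Φ` and displacement `[s; t]`. -/
def IsGaussianWith {n : ℕ} (ψ : L2 n) (s t : Config n) (Φ : Matrix (Fin n) (Fin n) ℂ) : Prop :=
  IsPhaseMatrix Φ ∧ ∃ α ∈ Set.Ico (0 : ℝ) (2 * Real.pi), ψ =ᵐ[volume] gaussianWave α s t Φ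

/-- The `n`-qumode Gaussian states. -/
def GaussianState (n : ℕ) : Type :=
  {ψ : L2 n // ∃ (s t : Config n) (Φ : Matrix (Fin n) (Fin n) ℂ), IsGaussianWith ψ s t Φ}

/-- Two Gaussian states are equivalent if they differ by a global phase `exp(iθ)`. -/
def phaseSetoid (n : ℕ) : Setoid (GaussianState n) where
  r ψ χ := ∃ θ : ℝ, χ.1 = Complex.exp (Complex.I * θ) • ψ.1
  iseqv :=
    { refl := fun ψ => ⟨0, by simp⟩
      symm := by
        rintro ψ χ ⟨θ, h⟩
        refine ⟨-θ, ?_⟩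
        rw [h, smul_smul, ← Complex.exp_add]
        simp
      trans := by
        rintro ψ χ ρ ⟨θ, h⟩ ⟨η, k⟩
        refine ⟨η + θ, ?_⟩
        rw [k, h, smul_smul, ← Complex.exp_add]
        congr 2
        push_cast
        ring }

/-- The Wigner transform
`W([q; p]) = π⁻ⁿ ∫ conj (φ (q + ξ)) φ (q - ξ) exp(2i ξᵀp) dξ`. -/
def wigner {n : ℕ} (φ : Config n → ℂ) (u : Phase n) : ℂ :=
  (1 / (Real.pi : ℂ) ^ n) * ∫ ξ : Config n,
    starRingEnd ℂ (φ (upper u + ξ)) * φ (upper u - ξ) *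
      Complex.exp (2 * Complex.I * ((∑ i, ξ i * lower u i : ℝ) : ℂ))

/-- The Wigner transform depends only on the class of the function in `L²`. -/
theorem wigner_congr_ae {n : ℕ} {φ χ : Config n → ℂ} (h : φ =ᵐ[volume] χ) :
    wigner φ = wigner χ := by
  funext u
  unfold wigner
  congr 1
  apply integral_congr_ae
  have h1 : ∀ᵐ ξ : Config n, φ (upper u + ξ) = χ (upper u + ξ) :=
    (measurePreserving_add_left volume (upper u)).quasiMeasurePreserving.ae h
  have h2 : ∀ᵐ ξ : Config n, φ (upper u - ξ) = χ (upper u - ξ) :=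
    (Measure.measurePreserving_sub_left volume (upper u)).quasiMeasurePreserving.ae h
  filter_upwards [h1, h2] with ξ a b
  rw [a, b]

/-- The Wigner transform is invariant under a global phase. -/
theorem wigner_phase {n : ℕ} (θ : ℝ) (ψ : L2 n) :
    wigner (Complex.exp (Complex.I * θ) • ψ : L2 n) = wigner ψ := by
  rw [wigner_congr_ae (Lp.coeFn_smul _ ψ)]
  funext u
  unfold wigner
  congr 1
  congr 1
  funext ξ
  have h : starRingEnd ℂ (Complex.exp (Complex.I * θ)) * Complex.exp (Complex.I * θ) = 1 := by
    rw [← Complex.exp_conj, ← Complex.exp_add]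
    simp
  simp only [Pi.smul_apply, smul_eq_mul, map_mul]
  linear_combination (starRingEnd ℂ (ψ (upper u + ξ)) * ψ (upper u - ξ) *
      Complex.exp (2 * Complex.I * ((∑ i, ξ i * lower u i : ℝ) : ℂ))) * h

/-- The Wigner transform on Gaussian states modulo global phase. -/
def wignerRay (n : ℕ) : Quotient (phaseSetoid n) → Phase n → ℂ :=
  Quotient.lift (fun ψ : GaussianState n => wigner ψ.1) (by
    rintro ψ χ ⟨θ, h⟩
    change wigner ψ.1 = wigner χ.1
    rw [h, wigner_phase])

/-- The matrix `Ω` of the standard symplectic form. -/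
def Omega (n : ℕ) : Matrix (Fin n ⊕ Fin n) (Fin n ⊕ Fin n) ℝ := Matrix.fromBlocks 0 1 (-1) 0

/-- `Δ` is symmetric, `det Δ = 1` and `Δ + iΩ ⪰ 0`. -/
def IsPure {n : ℕ} (Δ : Matrix (Fin n ⊕ Fin n) (Fin n ⊕ Fin n) ℝ) : Prop :=
  Δ.IsSymm ∧ Δ.det = 1 ∧
    (Δ.map Complex.ofReal + Complex.I • (Omega n).map Complex.ofReal).PosSemidef

/-- The matrix `Σ` attached to a phase matrix. -/
def sigmaOf {n : ℕ} (Φ : Matrix (Fin n) (Fin n) ℂ) :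
    Matrix (Fin n ⊕ Fin n) (Fin n ⊕ Fin n) ℝ :=
  Matrix.fromBlocks
    (imMat Φ + reMat Φ * (imMat Φ)⁻¹ * reMat Φ) (-(reMat Φ * (imMat Φ)⁻¹))
    (-((imMat Φ)⁻¹ * reMat Φ)) (imMat Φ)⁻¹

/-- The phase matrix `-B C⁻¹ + i C⁻¹`. -/
def phaseOf {n : ℕ} (B C : Matrix (Fin n) (Fin n) ℝ) : Matrix (Fin n) (Fin n) ℂ :=
  (-(B * C⁻¹)).map Complex.ofReal + Complex.I • (C⁻¹).map Complex.ofReal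

/-- The density of the Gaussian distribution with covariance matrix `S ≻ 0` and mean `m`:
`exp(-(u - m)ᵀ S⁻¹ (u - m) / 2) / √((2π)^N det S)`, where `N = 2n`. -/
def gaussianDensity {n : ℕ} (S : Matrix (Fin n ⊕ Fin n) (Fin n ⊕ Fin n) ℝ) (m u : Phase n) : ℝ :=
  Real.exp (-(1 / 2) * ((fun i => u i - m i) ⬝ᵥ S⁻¹ *ᵥ (fun i => u i - m i))) /
    Real.sqrt ((2 * Real.pi) ^ (2 * n) * S.det)

/-- `f` is the density function of the Gaussian distribution with (positive definite) covariance
matrix `S` and mean `m`: it is given everywhere by the explicit formula, and it is a density, with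
respect to Lebesgue measure, of the Gaussian measure. -/
def IsDensityOfGaussian {n : ℕ} (f : Phase n → ℂ)
    (S : Matrix (Fin n ⊕ Fin n) (Fin n ⊕ Fin n) ℝ) (m : Phase n) : Prop :=
  S.PosDef ∧ (∀ u, f u = (gaussianDensity S m u : ℂ)) ∧
    volume.withDensity (fun u => ENNReal.ofReal (f u).re) = multivariateGaussian m S

/-- The linear map `√2 Ω : [q; p] ↦ √2 [p; -q]` of phase space. -/
def rescaledRotation {n : ℕ} (u : Phase n) : Phase n :=
  column (Real.sqrt 2 • lower u) (-(Real.sqrt 2 • upper u))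

end GaussWigner

end

/-!
Write `Δ` in blocks `A`, `B`, `Bᵀ`, `C`. The matrix `Δ + iΩ` is positive semidefinite if and only if
its Schur complement `(A - B C⁻¹ Bᵀ - C⁻¹) + i (B C⁻¹ - C⁻¹ Bᵀ)` is. The real part `P` of the latter
is then positive semidefinite, and `det Δ = 1` says `det (C⁻¹ + P) = det C⁻¹`; since
`1 + tr Q ≤ det (1 + Q)` for `Q ⪰ 0`, this forces `P = 0`. What remains is `i (K - Kᵀ) ⪰ 0` with
`K = B C⁻¹`, a matrix of trace zero, so `K` is symmetric. Hence the pure matrices are exactly the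
matrices `Σ` of phase matrices, with `Φ = -B C⁻¹ + i C⁻¹`. They are symplectic, so
`Ω Σ⁻¹ Ωᵀ = Σ`, which gives the covariance of the rotated distribution.

The squared modulus of a Gaussian wave function with phase matrix `X + iY` is the normal density
with covariance `½ Y⁻¹`. By the parallelogram law, the Wigner integrand at `(q, p)` is
`exp (-(q - t)ᵀ Y (q - t))` times the centred version of this density times the character
`ξ ↦ exp (2i ξᵀ (p - s - X (q - t)))`, so the Wigner integral is a value of the characteristic
function of a Gaussian measure.
-/

namespace GaussWigner

section SymmetricMatrices

theorem exists_eq_fromBlocks_of_isSymm {m n R : Type*} {M : Matrix (m ⊕ n) (m ⊕ n) R}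
    (hM : M.IsSymm) :
    ∃ (A : Matrix m m R) (B : Matrix m n R) (C : Matrix n n R), M = Matrix.fromBlocks A B Bᵀ C := by
  refine ⟨M.toBlocks₁₁, M.toBlocks₁₂, M.toBlocks₂₂, ?_⟩
  have h : M.toBlocks₁₂ᵀ = M.toBlocks₂₁ := Matrix.ext fun i j => hM.apply (Sum.inr i) (Sum.inl j)
  rw [h, Matrix.fromBlocks_toBlocks]

variable {ι R : Type*} [Fintype ι] [CommRing R]

theorem inv_mul_transpose_of_isSymm {m : Type*} [DecidableEq ι] {C : Matrix ι ι R}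
    (hC : C.IsSymm) (B : Matrix m ι R) : C⁻¹ * Bᵀ = (B * C⁻¹)ᵀ := by
  rw [Matrix.transpose_mul, Matrix.transpose_nonsing_inv, hC]

theorem dotProduct_mulVec_add_self_add_sub_self (M : Matrix ι ι R) (a x : ι → R) :
    (a + x) ⬝ᵥ M *ᵥ (a + x) + (a - x) ⬝ᵥ M *ᵥ (a - x) =
      2 * (a ⬝ᵥ M *ᵥ a + x ⬝ᵥ M *ᵥ x) := by
  simp only [Matrix.mulVec_add, Matrix.mulVec_sub, dotProduct_add, dotProduct_sub, add_dotProduct,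
    sub_dotProduct]
  ring

theorem dotProduct_mulVec_comm_of_isSymm {S : Type*} [CommSemiring S] {M : Matrix ι ι S}
    (hM : M.IsSymm) (a x : ι → S) :
    a ⬝ᵥ M *ᵥ x = x ⬝ᵥ M *ᵥ a := by
  rw [Matrix.dotProduct_mulVec, ← Matrix.mulVec_transpose, hM, dotProduct_comm]

theorem dotProduct_mulVec_sub_self_sub_add_self {M : Matrix ι ι R} (hM : M.IsSymm)
    (a x : ι → R) :
    (a - x) ⬝ᵥ M *ᵥ (a - x) - (a + x) ⬝ᵥ M *ᵥ (a + x) = -4 * (x ⬝ᵥ M *ᵥ a) := by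
  simp only [Matrix.mulVec_add, Matrix.mulVec_sub, dotProduct_add, dotProduct_sub, add_dotProduct,
    sub_dotProduct, dotProduct_mulVec_comm_of_isSymm hM a x]
  ring

end SymmetricMatrices

section PositiveMatrices

open scoped MatrixOrder

theorem one_add_sum_le_prod_one_add {ι R : Type*} [CommRing R] [LinearOrder R]
    [IsStrictOrderedRing R] (s : Finset ι) {f : ι → R} (hf : ∀ i ∈ s, 0 ≤ f i) :
    1 + ∑ i ∈ s, f i ≤ ∏ i ∈ s, (1 + f i) := by
  induction s using Finset.cons_induction with
  | empty => simp
  | cons a s ha ih =>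
    rw [Finset.forall_mem_cons] at hf
    rw [Finset.sum_cons, Finset.prod_cons]
    nlinarith [mul_le_mul_of_nonneg_left (ih hf.2) (add_nonneg zero_le_one hf.1),
      mul_nonneg hf.1 (Finset.sum_nonneg hf.2)]

variable {𝕜 ι : Type*} [RCLike 𝕜] [Fintype ι] [DecidableEq ι]

theorem det_one_add_eq_prod_eigenvalues {P : Matrix ι ι 𝕜} (hP : P.IsHermitian) :
    (1 + P).det = ∏ i, (1 + hP.eigenvalues i : 𝕜) := by
  have h := P.eval_charpoly (-1)
  have hneg : Matrix.scalar ι (-1 : 𝕜) - P = -(1 + P) := by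
    rw [map_neg, map_one, neg_add, sub_eq_add_neg]
  rw [hP.charpoly_eq, Polynomial.eval_prod, hneg, Matrix.det_neg] at h
  simp_rw [Polynomial.eval_sub, Polynomial.eval_X, Polynomial.eval_C, ← neg_add',
    Finset.prod_neg, Finset.card_univ] at h
  exact (mul_left_cancel₀ (pow_ne_zero _ (neg_ne_zero.mpr one_ne_zero)) h).symm

theorem one_add_trace_le_det_one_add {P : Matrix ι ι 𝕜} (hP : P.PosSemidef) :
    1 + P.trace ≤ (1 + P).det := by
  rw [det_one_add_eq_prod_eigenvalues hP.1, hP.1.trace_eq_sum_eigenvalues]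
  exact_mod_cast one_add_sum_le_prod_one_add Finset.univ fun i _ => hP.eigenvalues_nonneg i

theorem eq_zero_of_det_add_eq {A P : Matrix ι ι 𝕜} (hA : A.PosDef) (hP : P.PosSemidef)
    (h : (A + P).det = A.det) : P = 0 := by
  obtain ⟨R, rfl⟩ := CStarAlgebra.nonneg_iff_eq_star_mul_self.mp hA.posSemidef.nonneg
  rw [Matrix.star_eq_conjTranspose] at hA h
  have hR : IsUnit R.det := by
    have := hA.det_pos.ne'
    rw [Matrix.det_mul] at this
    exact (right_ne_zero_of_mul this).isUnit
  set Q := R⁻¹ᴴ * P * R⁻¹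
  have hRP : P = Rᴴ * Q * R := by
    have hR' : R⁻¹ * R = 1 := Matrix.nonsing_inv_mul _ hR
    have hR'' : Rᴴ * R⁻¹ᴴ = 1 := by
      rw [← Matrix.conjTranspose_mul, hR', Matrix.conjTranspose_one]
    rw [← Matrix.mul_assoc, ← Matrix.mul_assoc, hR'', one_mul, Matrix.mul_assoc, hR', mul_one]
  have hQ : Q.PosSemidef := hP.conjTranspose_mul_mul_same _
  have hdet : (1 + Q).det = 1 := by
    have e : Rᴴ * R + P = Rᴴ * (1 + Q) * R := by rw [mul_add, add_mul, mul_one, ← hRP]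
    rw [e, Matrix.det_mul_right_comm, Matrix.det_mul] at h
    exact mul_left_cancel₀ hA.det_pos.ne' (h.trans (mul_one _).symm)
  have htr := one_add_trace_le_det_one_add hQ
  rw [hdet, add_le_iff_nonpos_right] at htr
  rw [hRP, hQ.trace_eq_zero_iff.mp (htr.antisymm hQ.trace_nonneg), mul_zero, zero_mul]

end PositiveMatrices

section Complexification

open scoped MatrixOrder

variable {ι : Type*} [Finite ι]

theorem posSemidef_map_re {M : Matrix ι ι ℂ} (hM : M.PosSemidef) :
    (M.map Complex.re).PosSemidef := by
  have := Fintype.ofFinite ι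
  refine .of_dotProduct_mulVec_nonneg ?_ fun x => ?_
  · ext i j
    rw [Matrix.conjTranspose_apply, Matrix.map_apply, Matrix.map_apply, ← hM.1.apply i j]
    rfl
  · have h := hM.re_dotProduct_nonneg (fun i => (x i : ℂ))
    simpa [dotProduct, Matrix.mulVec] using h

theorem posDef_map_ofReal {A : Matrix ι ι ℝ} (hA : A.PosDef) :
    (A.map Complex.ofReal).PosDef := by
  classical
  have := Fintype.ofFinite ι
  have hdet : (A.map Complex.ofReal).det = A.det := (Complex.ofRealHom.map_det A).symm
  rw [Matrix.PosSemidef.posDef_iff_det_ne_zero, hdet]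
  · exact_mod_cast hA.det_pos.ne'
  · obtain ⟨R, rfl⟩ := CStarAlgebra.nonneg_iff_eq_star_mul_self.mp hA.posSemidef.nonneg
    have e : (star R * R).map Complex.ofReal =
        (R.map Complex.ofReal)ᴴ * R.map Complex.ofReal := by
      ext i j
      simp [Matrix.mul_apply]
    exact e ▸ Matrix.posSemidef_conjTranspose_mul_self _

theorem isSymm_of_posSemidef_I_smul_sub_transpose {K : Matrix ι ι ℝ}
    (h : (Complex.I • (K - Kᵀ).map Complex.ofReal).PosSemidef) : K.IsSymm := by
  have := Fintype.ofFinite ι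
  have hzero := h.trace_eq_zero_iff.mp (by simp [Matrix.trace])
  ext i j
  have hij := congrFun₂ hzero j i
  simpa [← Complex.ofReal_sub, sub_eq_zero] using hij

end Complexification

section PureMatrices

variable {n : ℕ}

theorem IsPure.posDef {Δ : Matrix (Fin n ⊕ Fin n) (Fin n ⊕ Fin n) ℝ} (h : IsPure Δ) :
    Δ.PosDef := by
  obtain ⟨-, hdet, hpos⟩ := h
  have hre : (Δ.map Complex.ofReal + Complex.I • (Omega n).map Complex.ofReal).map Complex.re =
      Δ := by
    ext i j
    simp
  rw [Matrix.PosSemidef.posDef_iff_det_ne_zero (hre ▸ posSemidef_map_re hpos), hdet]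
  exact one_ne_zero

theorem IsPure.isUnit_det {Δ : Matrix (Fin n ⊕ Fin n) (Fin n ⊕ Fin n) ℝ} (h : IsPure Δ) :
    IsUnit Δ.det :=
  h.2.1 ▸ isUnit_one

theorem posSemidef_fromBlocks_add_Omega_iff {A B C : Matrix (Fin n) (Fin n) ℝ} (hC : C.PosDef) :
    ((Matrix.fromBlocks A B Bᵀ C).map Complex.ofReal +
        Complex.I • (Omega n).map Complex.ofReal).PosSemidef ↔
      ((A - B * C⁻¹ * Bᵀ - C⁻¹).map Complex.ofReal +
        Complex.I • (B * C⁻¹ - C⁻¹ * Bᵀ).map Complex.ofReal).PosSemidef := by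
  set c := Complex.ofRealHom.mapMatrix (m := Fin n)
  have hCc : (c C).PosDef := posDef_map_ofReal hC
  have : Invertible (c C) := hCc.isUnit.invertible
  have hinv : (c C)⁻¹ = c C⁻¹ := by
    apply Matrix.inv_eq_right_inv
    rw [← map_mul, Matrix.mul_nonsing_inv _ hC.det_pos.ne'.isUnit, map_one]
  have hB : (c B + Complex.I • 1)ᴴ = c Bᵀ - Complex.I • 1 := by
    ext i j
    simp [c, Matrix.one_apply, sub_eq_add_neg, eq_comm, apply_ite]
  have hblocks : (Matrix.fromBlocks A B Bᵀ C).map Complex.ofReal +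
      Complex.I • (Omega n).map Complex.ofReal =
      Matrix.fromBlocks (c A) (c B + Complex.I • 1) (c B + Complex.I • 1)ᴴ (c C) := by
    rw [hB, Omega, Matrix.fromBlocks_map, Matrix.fromBlocks_map, Matrix.fromBlocks_smul,
      Matrix.fromBlocks_add]
    congr 1 <;> ext i j <;> simp [c, sub_eq_add_neg, Matrix.one_apply, apply_ite]
  rw [hblocks, hCc.fromBlocks₂₂ (c A) (c B + Complex.I • 1)]
  change (_ - _ * (c C)⁻¹ * _).PosSemidef ↔ (c _ + Complex.I • c _).PosSemidef
  rw [hB, hinv]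
  simp only [map_sub, map_mul, add_mul, mul_sub, smul_mul_assoc, mul_smul_comm, one_mul, mul_one,
    smul_add, smul_sub, smul_smul, Complex.I_mul_I, neg_smul, one_smul]
  rw [iff_iff_eq]
  congr 1
  abel

theorem IsPure.schur_eq_inv {A B C : Matrix (Fin n) (Fin n) ℝ} (hC : C.PosDef)
    (h : IsPure (Matrix.fromBlocks A B Bᵀ C)) : A - B * C⁻¹ * Bᵀ = C⁻¹ := by
  have hpos := posSemidef_map_re ((posSemidef_fromBlocks_add_Omega_iff hC).mp h.2.2)
  have hre : ((A - B * C⁻¹ * Bᵀ - C⁻¹).map Complex.ofReal + Complex.I •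
      (B * C⁻¹ - C⁻¹ * Bᵀ).map Complex.ofReal).map Complex.re = A - B * C⁻¹ * Bᵀ - C⁻¹ := by
    ext i j
    simp
  rw [hre] at hpos
  refine sub_eq_zero.mp (eq_zero_of_det_add_eq hC.inv hpos ?_)
  have := hC.isUnit.invertible
  have hdet := h.2.1
  rw [Matrix.det_fromBlocks₂₂, Matrix.invOf_eq_nonsing_inv] at hdet
  rw [add_sub_cancel, Matrix.det_nonsing_inv, Ring.inverse_eq_inv']
  exact eq_inv_of_mul_eq_one_right hdet

theorem isPure_fromBlocks_iff {A B C : Matrix (Fin n) (Fin n) ℝ} :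
    IsPure (Matrix.fromBlocks A B Bᵀ C) ↔
      C.PosDef ∧ (B * C⁻¹).IsSymm ∧ A = C⁻¹ + B * C⁻¹ * Bᵀ := by
  constructor
  · intro h
    have hC : C.PosDef := h.posDef.submatrix (e := Sum.inr) Sum.inr_injective
    have hschur := h.schur_eq_inv hC
    have hCs : C.IsSymm := hC.1
    refine ⟨hC, ?_, sub_eq_iff_eq_add.mp hschur⟩
    have hpos := (posSemidef_fromBlocks_add_Omega_iff hC).mp h.2.2
    rw [hschur, sub_self, inv_mul_transpose_of_isSymm hCs,
      Matrix.map_zero _ Complex.ofReal_zero, zero_add] at hpos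
    exact isSymm_of_posSemidef_I_smul_sub_transpose hpos
  · rintro ⟨hC, hB, rfl⟩
    have hCs : C.IsSymm := hC.1
    refine ⟨?_, ?_, ?_⟩
    · have hA : (C⁻¹ + B * C⁻¹ * Bᵀ).IsSymm := by
        simpa using (hC.inv.posSemidef.add (hC.inv.posSemidef.mul_mul_conjTranspose_same B)).1
      exact hA.fromBlocks rfl hCs
    · have := hC.isUnit.invertible
      rw [Matrix.det_fromBlocks₂₂, Matrix.invOf_eq_nonsing_inv, add_sub_cancel_right,
        ← Matrix.det_mul, Matrix.mul_nonsing_inv _ hC.det_pos.ne'.isUnit, Matrix.det_one]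
    · rw [posSemidef_fromBlocks_add_Omega_iff hC, inv_mul_transpose_of_isSymm hCs, hB.eq,
        add_sub_cancel_right, sub_self, sub_self]
      simpa using Matrix.PosSemidef.zero

theorem IsPure.mem_symplecticGroup {Δ : Matrix (Fin n ⊕ Fin n) (Fin n ⊕ Fin n) ℝ}
    (h : IsPure Δ) : Δ ∈ Matrix.symplecticGroup (Fin n) ℝ := by
  obtain ⟨A, B, C, rfl⟩ := exists_eq_fromBlocks_of_isSymm h.1
  obtain ⟨hC, hK, hA⟩ := isPure_fromBlocks_iff.mp h
  have hu : IsUnit C.det := hC.det_pos.ne'.isUnit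
  have hCt : Cᵀ = C := hC.1
  obtain ⟨K, rfl⟩ : ∃ K, B = K * C := ⟨_, (Matrix.nonsing_inv_mul_cancel_right _ _ hu).symm⟩
  rw [Matrix.mul_nonsing_inv_cancel_right _ _ hu] at hK hA
  have hKt : Kᵀ = K := hK
  have hAt : Aᵀ = A := (Matrix.isSymm_fromBlocks_iff.mp h.1).1
  rw [SymplecticGroup.fromBlocks_mem_iff, Matrix.transpose_transpose, Matrix.transpose_mul, hAt,
    hCt, hKt, hA, Matrix.transpose_mul, hCt, hKt]
  refine ⟨?_, by rw [mul_assoc], ?_⟩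
  · rw [add_mul, mul_add, Matrix.nonsing_inv_mul_cancel_left _ _ hu,
      Matrix.mul_nonsing_inv_cancel_right _ _ hu]
    simp only [mul_assoc]
  · rw [add_mul, Matrix.nonsing_inv_mul _ hu]
    simp only [mul_assoc, add_sub_cancel_right]

theorem IsPure.Omega_mul_inv_mul_transpose {Δ : Matrix (Fin n ⊕ Fin n) (Fin n ⊕ Fin n) ℝ}
    (h : IsPure Δ) : Omega n * Δ⁻¹ * (Omega n)ᵀ = Δ := by
  have hJ : Omega n = -Matrix.J (Fin n) ℝ := by
    rw [Omega, Matrix.J, Matrix.fromBlocks_neg, neg_zero, neg_neg]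
  rw [SymplecticGroup.inv_eq_symplectic_inv _ h.mem_symplecticGroup, hJ, h.1.eq,
    Matrix.transpose_neg, Matrix.J_transpose, neg_neg]
  simp only [neg_mul, mul_neg, mul_assoc, Matrix.J_squared]
  simp only [← mul_assoc, Matrix.J_squared]
  simp

end PureMatrices

section PhaseMatrices

variable {n : ℕ} {Φ : Matrix (Fin n) (Fin n) ℂ}

theorem IsPhaseMatrix.reMat_isSymm (h : IsPhaseMatrix Φ) : (reMat Φ).IsSymm :=
  h.1.map Complex.re

theorem IsPhaseMatrix.isUnit_det_imMat (h : IsPhaseMatrix Φ) : IsUnit (imMat Φ).det :=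
  h.2.det_pos.ne'.isUnit

theorem reMat_phaseOf (B C : Matrix (Fin n) (Fin n) ℝ) : reMat (phaseOf B C) = -(B * C⁻¹) := by
  ext i j
  simp [reMat, phaseOf]

theorem imMat_phaseOf (B C : Matrix (Fin n) (Fin n) ℝ) : imMat (phaseOf B C) = C⁻¹ := by
  ext i j
  simp [imMat, phaseOf]

theorem IsPhaseMatrix.isPure_sigmaOf (h : IsPhaseMatrix Φ) : IsPure (sigmaOf Φ) := by
  have hu := h.isUnit_det_imMat
  have hX := h.reMat_isSymm.eq
  have hY : (imMat Φ).IsSymm := h.2.1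
  have hB : -((imMat Φ)⁻¹ * reMat Φ) = (-(reMat Φ * (imMat Φ)⁻¹))ᵀ := by
    rw [Matrix.transpose_neg, ← inv_mul_transpose_of_isSymm hY, hX]
  rw [sigmaOf, hB, isPure_fromBlocks_iff, ← hB, Matrix.nonsing_inv_nonsing_inv _ hu, neg_mul,
    Matrix.nonsing_inv_mul_cancel_right _ _ hu, neg_mul_neg, ← mul_assoc]
  exact ⟨h.2.inv, h.reMat_isSymm.neg, rfl⟩

theorem IsPure.isPhaseMatrix_phaseOf {A B C : Matrix (Fin n) (Fin n) ℝ}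
    (h : IsPure (Matrix.fromBlocks A B Bᵀ C)) : IsPhaseMatrix (phaseOf B C) := by
  obtain ⟨hC, hK, -⟩ := isPure_fromBlocks_iff.mp h
  have hCs : C⁻¹.IsSymm := hC.inv.1
  exact ⟨(hK.neg.map _).add ((hCs.map _).smul _), (imMat_phaseOf B C).symm ▸ hC.inv⟩

theorem IsPure.sigmaOf_phaseOf {A B C : Matrix (Fin n) (Fin n) ℝ}
    (h : IsPure (Matrix.fromBlocks A B Bᵀ C)) :
    sigmaOf (phaseOf B C) = Matrix.fromBlocks A B Bᵀ C := by
  obtain ⟨hC, hK, hA⟩ := isPure_fromBlocks_iff.mp h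
  have hu : IsUnit C.det := hC.det_pos.ne'.isUnit
  have hCs : C.IsSymm := hC.1
  have hKt : B * C⁻¹ = C⁻¹ * Bᵀ := by rw [inv_mul_transpose_of_isSymm hCs, hK.eq]
  rw [sigmaOf, reMat_phaseOf, imMat_phaseOf, Matrix.nonsing_inv_nonsing_inv _ hu, hA, neg_mul,
    Matrix.nonsing_inv_mul_cancel_right _ _ hu, neg_mul_neg, mul_neg, neg_neg, neg_neg, mul_assoc B,
    ← hKt, hKt, Matrix.mul_nonsing_inv_cancel_left _ _ hu]

theorem IsPhaseMatrix.phaseOf_sigmaOf (h : IsPhaseMatrix Φ) :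
    phaseOf (sigmaOf Φ).toBlocks₁₂ (sigmaOf Φ).toBlocks₂₂ = Φ := by
  have hu := h.isUnit_det_imMat
  rw [sigmaOf, Matrix.toBlocks_fromBlocks₁₂, Matrix.toBlocks_fromBlocks₂₂, phaseOf,
    Matrix.nonsing_inv_nonsing_inv _ hu, neg_mul, Matrix.nonsing_inv_mul_cancel_right _ _ hu,
    neg_neg]
  ext i j
  simp [reMat, imMat, mul_comm Complex.I, Complex.re_add_im]

theorem sigmaOf_injOn : Set.InjOn (sigmaOf (n := n)) {Φ | IsPhaseMatrix Φ} := fun Φ hΦ Ψ hΨ h => by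
  rw [← IsPhaseMatrix.phaseOf_sigmaOf hΦ, h, IsPhaseMatrix.phaseOf_sigmaOf hΨ]

end PhaseMatrices

section GaussianDensities

open scoped MatrixOrder

theorem map_withDensity_comp {X Y : Type*} [MeasurableSpace X] [MeasurableSpace Y]
    {μ : Measure X} {f : X → Y} (hf : Measurable f) {g : Y → ENNReal} (hg : Measurable g) :
    (μ.withDensity fun x => g (f x)).map f = (μ.map f).withDensity g := by
  ext s hs
  rw [Measure.map_apply hf hs, withDensity_apply _ (hf hs), withDensity_apply _ hs,
    setLIntegral_map hs hg hf]

theorem map_const_add_linearMap_eq_smul {E : Type*} [NormedAddCommGroup E] [NormedSpace ℝ E]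
    [MeasurableSpace E] [BorelSpace E] [FiniteDimensional ℝ E] (μ : Measure E)
    [μ.IsAddHaarMeasure] (m : E) {f : E →ₗ[ℝ] E} (hf : LinearMap.det f ≠ 0) :
    μ.map (fun x => m + f x) = ENNReal.ofReal |(LinearMap.det f)⁻¹| • μ := by
  have hf' : Measurable f := f.continuous_of_finiteDimensional.measurable
  change μ.map ((m + ·) ∘ f) = _
  rw [← Measure.map_map (measurable_const_add m) hf',
    Measure.map_linearMap_addHaar_eq_smul_addHaar μ hf, Measure.map_smul, map_add_left_eq_self]

theorem charFun_withDensity_ofReal {E : Type*} [NormedAddCommGroup E] [InnerProductSpace ℝ E]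
    [MeasurableSpace E] (μ : Measure E) {f : E → ℝ} (hf : Measurable f) (hf' : ∀ x, 0 ≤ f x)
    (t : E) :
    charFun (μ.withDensity fun x => ENNReal.ofReal (f x)) t =
      ∫ x, f x * Complex.exp (inner ℝ x t * Complex.I) ∂μ := by
  rw [charFun_apply, integral_withDensity_eq_integral_toReal_smul hf.ennreal_ofReal (by simp)]
  simp_rw [ENNReal.toReal_ofReal (hf' _), Complex.real_smul]

variable {ι : Type*} [Fintype ι] [DecidableEq ι]

/-- The density of the Gaussian distribution on `ℝ^ι` with mean `m` and covariance matrix `S ≻ 0`;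
the case of phase space is `gaussianDensity`. -/
noncomputable def normalDensity (m : EuclideanSpace ℝ ι) (S : Matrix ι ι ℝ)
    (u : EuclideanSpace ℝ ι) : ℝ :=
  Real.exp (-(1 / 2) * ((u - m).ofLp ⬝ᵥ S⁻¹ *ᵥ (u - m).ofLp)) /
    √((2 * Real.pi) ^ Fintype.card ι * S.det)

theorem normalDensity_nonneg (m : EuclideanSpace ℝ ι) (S : Matrix ι ι ℝ)
    (u : EuclideanSpace ℝ ι) : 0 ≤ normalDensity m S u := by
  unfold normalDensity
  positivity

theorem continuous_normalDensity (m : EuclideanSpace ℝ ι) (S : Matrix ι ι ℝ) :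
    Continuous (normalDensity m S) := by
  unfold normalDensity dotProduct Matrix.mulVec dotProduct
  fun_prop

theorem normalDensity_zero_one (x : EuclideanSpace ℝ ι) :
    normalDensity 0 1 x = Real.exp (-(1 / 2) * ‖x‖ ^ 2) / √((2 * Real.pi) ^ Fintype.card ι) := by
  rw [normalDensity, sub_zero, inv_one, Matrix.one_mulVec, Matrix.det_one, mul_one,
    EuclideanSpace.real_norm_sq_eq, dotProduct]
  simp only [sq]

theorem normalDensity_add_sqrt (m : EuclideanSpace ℝ ι) {S : Matrix ι ι ℝ} (hS : S.PosDef)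
    (x : EuclideanSpace ℝ ι) :
    normalDensity 0 1 x =
      √S.det * normalDensity m S (m + Matrix.toEuclideanCLM (𝕜 := ℝ) (CFC.sqrt S) x) := by
  have hpos : 0 < √S.det := Real.sqrt_pos.mpr hS.det_pos
  have hsq : CFC.sqrt S * CFC.sqrt S = S := CFC.sqrt_mul_sqrt_self S hS.posSemidef.nonneg
  have hsymm : (CFC.sqrt S)ᵀ = CFC.sqrt S :=
    (Matrix.nonneg_iff_posSemidef.mp (CFC.sqrt_nonneg S)).1
  have hunit : IsUnit (CFC.sqrt S).det := by
    refine isUnit_of_mul_isUnit_left (y := (CFC.sqrt S).det) ?_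
    rw [← Matrix.det_mul, hsq]
    exact hS.det_pos.ne'.isUnit
  have hinv : S⁻¹ = (CFC.sqrt S)⁻¹ * (CFC.sqrt S)⁻¹ := by rw [← Matrix.mul_inv_rev, hsq]
  have hquad : (CFC.sqrt S *ᵥ x.ofLp) ⬝ᵥ S⁻¹ *ᵥ CFC.sqrt S *ᵥ x.ofLp = x.ofLp ⬝ᵥ x.ofLp := by
    rw [Matrix.mulVec_mulVec, hinv, Matrix.nonsing_inv_mul_cancel_right _ _ hunit,
      Matrix.dotProduct_mulVec, ← Matrix.mulVec_transpose, Matrix.mulVec_mulVec,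
      Matrix.transpose_nonsing_inv, hsymm, Matrix.nonsing_inv_mul _ hunit, Matrix.one_mulVec]
  rw [normalDensity, normalDensity, add_sub_cancel_left, sub_zero, inv_one, Matrix.one_mulVec,
    Matrix.det_one, mul_one, Matrix.ofLp_toEuclideanCLM, hquad, Real.sqrt_mul (by positivity)]
  field_simp

theorem stdGaussian_eq_withDensity :
    stdGaussian (EuclideanSpace ℝ ι) =
      volume.withDensity fun x => ENNReal.ofReal (normalDensity 0 1 x) := by
  have hc : (√((2 * Real.pi) ^ Fintype.card ι) : ℂ) =
      (Real.pi / (1 / 2 : ℂ)) ^ ((Module.finrank ℝ (EuclideanSpace ℝ ι) : ℂ) / 2) := by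
    rw [Real.sqrt_eq_rpow, ← Real.rpow_natCast, ← Real.rpow_mul (by positivity),
      Complex.ofReal_cpow (by positivity), finrank_euclideanSpace]
    push_cast
    ring_nf
  have hint : Integrable (normalDensity (0 : EuclideanSpace ℝ ι) 1) := by
    have h := (GaussianFourier.integrable_cexp_neg_mul_sq_norm_add (b := 1 / 2) (by norm_num) 0
      (0 : EuclideanSpace ℝ ι)).norm.div_const √((2 * Real.pi) ^ Fintype.card ι)
    refine h.congr (.of_forall fun x => ?_)
    simp [normalDensity_zero_one, Complex.norm_exp, ← Complex.ofReal_pow]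
  have := isFiniteMeasure_withDensity_ofReal hint.2
  refine Measure.ext_of_charFun (funext fun t => ?_)
  rw [charFun_withDensity_ofReal _ (continuous_normalDensity 0 1).measurable
    (normalDensity_nonneg 0 1), charFun_stdGaussian]
  have hfun : ∀ x, (normalDensity 0 1 x : ℂ) * Complex.exp (inner ℝ x t * Complex.I) =
      (√((2 * Real.pi) ^ Fintype.card ι) : ℂ)⁻¹ *
        Complex.exp (-(1 / 2) * ‖x‖ ^ 2 + Complex.I * inner ℝ t x) := fun x => by
    rw [normalDensity_zero_one, Complex.exp_add, real_inner_comm, mul_comm Complex.I]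
    push_cast
    ring
  simp_rw [hfun]
  rw [integral_const_mul, GaussianFourier.integral_cexp_neg_mul_sq_norm_add (by norm_num), ← hc,
    inv_mul_cancel_left₀ (by exact_mod_cast (by positivity)), Complex.I_sq]
  ring_nf

theorem multivariateGaussian_eq_withDensity (m : EuclideanSpace ℝ ι) {S : Matrix ι ι ℝ}
    (hS : S.PosDef) :
    multivariateGaussian m S =
      volume.withDensity fun u => ENNReal.ofReal (normalDensity m S u) := by
  have hpos : 0 < √S.det := Real.sqrt_pos.mpr hS.det_pos
  have hdet : LinearMap.det (Matrix.toEuclideanLin (CFC.sqrt S)) = √S.det :=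
    (LinearMap.det_toLpLin 2 _).trans (hS.posSemidef.det_sqrt.trans RCLike.sqrt_real)
  have hmap : (volume : Measure (EuclideanSpace ℝ ι)).map
      (fun x => m + Matrix.toEuclideanCLM (𝕜 := ℝ) (CFC.sqrt S) x) =
        ENNReal.ofReal (√S.det)⁻¹ • volume := by
    rw [← abs_of_pos (inv_pos.mpr hpos), ← hdet]
    exact map_const_add_linearMap_eq_smul volume m (hdet ▸ hpos.ne')
  have hmeas : Measurable fun u => ENNReal.ofReal (√S.det * normalDensity m S u) :=
    (continuous_const.mul (continuous_normalDensity m S)).measurable.ennreal_ofReal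
  simp_rw [multivariateGaussian, stdGaussian_eq_withDensity, normalDensity_add_sqrt m hS]
  rw [map_withDensity_comp (by fun_prop) hmeas, hmap, withDensity_smul_measure,
    ← withDensity_smul _ hmeas]
  congr 1
  ext u
  rw [Pi.smul_apply, smul_eq_mul, ← ENNReal.ofReal_mul (by positivity),
    inv_mul_cancel_left₀ hpos.ne']

theorem sqrt_normalDensity_add_mul_sqrt_normalDensity_sub
    (t : EuclideanSpace ℝ ι) (S : Matrix ι ι ℝ) (q ξ : EuclideanSpace ℝ ι) :
    √(normalDensity t S (q + ξ)) * √(normalDensity t S (q - ξ)) =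
      Real.exp (-(1 / 2) * ((q - t).ofLp ⬝ᵥ S⁻¹ *ᵥ (q - t).ofLp)) * normalDensity 0 S ξ := by
  have hquad := dotProduct_mulVec_add_self_add_sub_self S⁻¹ (q - t).ofLp ξ.ofLp
  rw [← WithLp.ofLp_add 2 (q - t), ← WithLp.ofLp_sub 2 (q - t), sub_add_eq_add_sub,
    sub_right_comm] at hquad
  rw [← Real.sqrt_mul (normalDensity_nonneg _ _ _),
    Real.sqrt_eq_iff_mul_self_eq (mul_nonneg (normalDensity_nonneg _ _ _)
      (normalDensity_nonneg _ _ _)) (mul_nonneg (Real.exp_nonneg _) (normalDensity_nonneg _ _ _))]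
  simp only [normalDensity, sub_zero]
  rw [div_mul_div_comm, ← mul_div_assoc, div_mul_div_comm]
  simp only [← Real.exp_add]
  congr 2
  linear_combination (-(1 / 2) : ℝ) * hquad

end GaussianDensities

section GaussianMeasures

variable {ι : Type*} [Fintype ι] [DecidableEq ι]

theorem integrable_normalDensity (m : EuclideanSpace ℝ ι) {S : Matrix ι ι ℝ} (hS : S.PosDef) :
    Integrable (normalDensity m S) := by
  refine ⟨(continuous_normalDensity m S).aestronglyMeasurable, ?_⟩
  rw [hasFiniteIntegral_iff_ofReal (.of_forall (normalDensity_nonneg m S)),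
    ← setLIntegral_univ, ← withDensity_apply _ .univ, ← multivariateGaussian_eq_withDensity m hS]
  exact measure_lt_top _ _

theorem half_smul_inv_posDef {Y : Matrix ι ι ℝ} (hY : Y.PosDef) :
    ((1 / 2 : ℝ) • Y⁻¹).PosDef :=
  hY.inv.smul (by norm_num)

theorem inv_half_smul_inv {Y : Matrix ι ι ℝ} (hY : IsUnit Y.det) :
    ((1 / 2 : ℝ) • Y⁻¹)⁻¹ = (2 : ℝ) • Y := by
  apply Matrix.inv_eq_right_inv
  rw [Matrix.smul_mul, Matrix.mul_smul, smul_smul, Matrix.nonsing_inv_mul _ hY]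
  norm_num

theorem half_smul_inv_injOn :
    Set.InjOn (fun Y : Matrix ι ι ℝ => (1 / 2 : ℝ) • Y⁻¹) {Y | IsUnit Y.det} := by
  intro Y hY Z hZ (h : (1 / 2 : ℝ) • Y⁻¹ = (1 / 2 : ℝ) • Z⁻¹)
  refine smul_right_injective _ (two_ne_zero : (2 : ℝ) ≠ 0) ?_
  change (2 : ℝ) • Y = (2 : ℝ) • Z
  rw [← inv_half_smul_inv hY, h, inv_half_smul_inv hZ]

theorem normalDensity_half_smul_inv (m : EuclideanSpace ℝ ι) {Y : Matrix ι ι ℝ} (hY : Y.PosDef)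
    (u : EuclideanSpace ℝ ι) :
    normalDensity m ((1 / 2 : ℝ) • Y⁻¹) u =
      √(Y.det / Real.pi ^ Fintype.card ι) *
        Real.exp (-((u - m).ofLp ⬝ᵥ Y *ᵥ (u - m).ofLp)) := by
  have hdet : (2 * Real.pi) ^ Fintype.card ι * ((1 / 2 : ℝ) • Y⁻¹).det =
      (Y.det / Real.pi ^ Fintype.card ι)⁻¹ := by
    rw [Matrix.det_smul, Matrix.det_nonsing_inv, Ring.inverse_eq_inv', ← mul_assoc, ← mul_pow,
      mul_right_comm, mul_one_div_cancel two_ne_zero, one_mul, inv_div, div_eq_mul_inv]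
  rw [normalDensity, inv_half_smul_inv hY.det_pos.ne'.isUnit, hdet, Real.sqrt_inv,
    div_inv_eq_mul, Matrix.smul_mulVec, dotProduct_smul, smul_eq_mul, mul_comm]
  ring_nf

theorem integral_normalDensity_mul_cexp {Y : Matrix ι ι ℝ} (hY : Y.PosDef)
    (v : EuclideanSpace ℝ ι) :
    ∫ ξ, normalDensity 0 ((1 / 2 : ℝ) • Y⁻¹) ξ * Complex.exp (2 * Complex.I * inner ℝ ξ v) =
      Real.exp (-(v.ofLp ⬝ᵥ Y⁻¹ *ᵥ v.ofLp)) := by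
  have hS := half_smul_inv_posDef hY
  have h := charFun_multivariateGaussian (μ := 0) hS.posSemidef ((2 : ℝ) • v)
  rw [multivariateGaussian_eq_withDensity 0 hS, charFun_withDensity_ofReal _
    (continuous_normalDensity _ _).measurable (normalDensity_nonneg _ _)] at h
  convert h using 1
  · congr 1 with ξ
    rw [inner_smul_right]
    push_cast
    ring_nf
  · rw [inner_zero_right, WithLp.ofLp_smul, Matrix.smul_mulVec, Matrix.mulVec_smul,
      dotProduct_smul, dotProduct_smul, smul_dotProduct]
    simp only [smul_eq_mul]
    push_cast
    ring_nf

theorem map_multivariateGaussian (m : EuclideanSpace ℝ ι) {S : Matrix ι ι ℝ} (hS : S.PosSemidef)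
    (M : Matrix ι ι ℝ) :
    (multivariateGaussian m S).map (Matrix.toEuclideanCLM (𝕜 := ℝ) M) =
      multivariateGaussian (Matrix.toEuclideanCLM (𝕜 := ℝ) M m) (M * S * Mᵀ) := by
  have hM : (M * S * Mᵀ).PosSemidef := by
    simpa only [Matrix.conjTranspose_eq_transpose_of_trivial] using hS.mul_mul_conjTranspose_same M
  have hadj : ∀ x y, inner ℝ (Matrix.toEuclideanCLM (𝕜 := ℝ) M y) x =
      inner ℝ y (Matrix.toEuclideanCLM (𝕜 := ℝ) Mᵀ x) := fun x y => by
    rw [Matrix.inner_toEuclideanCLM, real_inner_comm, Matrix.inner_toEuclideanCLM,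
      Matrix.dotProduct_mulVec, ← Matrix.mulVec_transpose, dotProduct_comm]
  refine Measure.ext_of_charFun (funext fun x => ?_)
  rw [charFun_multivariateGaussian hM, charFun_apply, integral_map (by fun_prop) (by fun_prop)]
  simp_rw [hadj]
  rw [← charFun_apply, charFun_multivariateGaussian hS, real_inner_comm, ← hadj, real_inner_comm,
    Matrix.ofLp_toEuclideanCLM, ← Matrix.mulVec_mulVec, ← Matrix.mulVec_mulVec,
    Matrix.dotProduct_mulVec x.ofLp M, Matrix.mulVec_transpose]

theorem multivariateGaussian_injOn :
    Set.InjOn (fun x : Matrix ι ι ℝ × EuclideanSpace ℝ ι => multivariateGaussian x.2 x.1)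
      {x | x.1.PosSemidef} := by
  rintro ⟨S, m⟩ (hS : S.PosSemidef) ⟨T, k⟩ (hT : T.PosSemidef)
    (h : multivariateGaussian m S = multivariateGaussian k T)
  refine Prod.ext (Matrix.ext fun i j => ?_) ?_
  · change S i j = T i j
    rw [← covariance_eval_multivariateGaussian (μ := m) hS, h,
      covariance_eval_multivariateGaussian hT]
  · change m = k
    rw [← integral_id_multivariateGaussian (μ := m) (S := S), h, integral_id_multivariateGaussian]

theorem multivariateGaussian_half_smul_inv_injOn :
    Set.InjOn (fun x : Matrix ι ι ℝ × EuclideanSpace ℝ ι =>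
      multivariateGaussian x.2 ((1 / 2 : ℝ) • x.1⁻¹)) {x | x.1.PosDef} := by
  rintro ⟨Y, m⟩ (hY : Y.PosDef) ⟨Z, k⟩ (hZ : Z.PosDef) h
  have hpair := Prod.mk.inj (multivariateGaussian_injOn
    (x₁ := ((1 / 2 : ℝ) • Y⁻¹, m)) (x₂ := ((1 / 2 : ℝ) • Z⁻¹, k))
    (half_smul_inv_posDef hY).posSemidef (half_smul_inv_posDef hZ).posSemidef h)
  exact Prod.ext (half_smul_inv_injOn hY.det_pos.ne'.isUnit hZ.det_pos.ne'.isUnit hpair.1) hpair.2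

end GaussianMeasures

section WaveFunctions

variable {n : ℕ} (α : ℝ) (s t : Config n) {Φ : Matrix (Fin n) (Fin n) ℂ}

/-- The argument of the wave function `gaussianWave α s t Φ` at `x`, as a real number. -/
noncomputable def wavePhase (Φ : Matrix (Fin n) (Fin n) ℂ) (x : Config n) : ℝ :=
  α + inner ℝ x s + 1 / 2 * ((x - t).ofLp ⬝ᵥ reMat Φ *ᵥ (x - t).ofLp)

theorem ofReal_dotProduct_mulVec (Φ : Matrix (Fin n) (Fin n) ℂ) (v : Fin n → ℝ) :
    (fun i => (v i : ℂ)) ⬝ᵥ Φ *ᵥ (fun i => (v i : ℂ)) =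
      ((v ⬝ᵥ reMat Φ *ᵥ v : ℝ) : ℂ) + Complex.I * ((v ⬝ᵥ imMat Φ *ᵥ v : ℝ) : ℂ) := by
  simp only [dotProduct, Matrix.mulVec, Complex.ofReal_sum, Complex.ofReal_mul, Finset.mul_sum,
    ← Finset.sum_add_distrib]
  refine Finset.sum_congr rfl fun i _ => Finset.sum_congr rfl fun j _ => ?_
  conv_lhs => rw [← Complex.re_add_im (Φ i j)]
  simp only [reMat, imMat, Matrix.map_apply]
  ring

theorem gaussianWave_eq (h : IsPhaseMatrix Φ) (x : Config n) :
    gaussianWave α s t Φ x = Complex.exp (Complex.I * wavePhase α s t Φ x) *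
      (√(normalDensity t ((1 / 2 : ℝ) • (imMat Φ)⁻¹) x) : ℝ) := by
  have hroot : ((imMat Φ).det / Real.pi ^ n) ^ (1 / 4 : ℝ) =
      √√((imMat Φ).det / Real.pi ^ n) := by
    have hdet := h.2.det_pos
    rw [Real.sqrt_eq_rpow, Real.sqrt_eq_rpow, ← Real.rpow_mul (by positivity)]
    norm_num
  have hquad := ofReal_dotProduct_mulVec Φ (x - t).ofLp
  simp only [PiLp.sub_apply] at hquad
  rw [normalDensity_half_smul_inv t h.2, Real.sqrt_mul (Real.sqrt_nonneg _), ← Real.exp_half,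
    Fintype.card_fin, gaussianWave, hroot, hquad, wavePhase, Complex.ofReal_mul,
    Complex.ofReal_exp, mul_left_comm _ (Complex.ofReal √_), ← Complex.exp_add,
    mul_right_comm, ← Complex.exp_add, ← Complex.exp_add, mul_comm]
  congr 2
  simp only [PiLp.inner_apply, RCLike.inner_apply, conj_trivial]
  push_cast
  linear_combination (1 / 2 * ((x - t).ofLp ⬝ᵥ imMat Φ *ᵥ (x - t).ofLp : ℝ) : ℂ) * Complex.I_sq

theorem continuous_gaussianWave (Φ : Matrix (Fin n) (Fin n) ℂ) :
    Continuous (gaussianWave α s t Φ) := by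
  unfold gaussianWave
  simp only [dotProduct, Matrix.mulVec]
  fun_prop

theorem memLp_gaussianWave (h : IsPhaseMatrix Φ) : MemLp (gaussianWave α s t Φ) 2 volume := by
  rw [memLp_two_iff_integrable_sq_norm (continuous_gaussianWave α s t Φ).aestronglyMeasurable]
  refine (integrable_normalDensity t (half_smul_inv_posDef h.2)).congr (.of_forall fun x => ?_)
  simp only [gaussianWave_eq α s t h, norm_mul, mul_comm Complex.I, Complex.norm_exp_ofReal_mul_I,
    one_mul, Complex.norm_real, Real.norm_eq_abs, sq_abs]
  rw [Real.sq_sqrt (normalDensity_nonneg _ _ _)]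

theorem gaussianWave_phase (θ : ℝ) (Φ : Matrix (Fin n) (Fin n) ℂ) (x : Config n) :
    gaussianWave (θ + α) s t Φ x = Complex.exp (Complex.I * θ) * gaussianWave α s t Φ x := by
  rw [gaussianWave, gaussianWave, Complex.ofReal_add, mul_add, Complex.exp_add]
  ring

theorem wavePhase_sub_sub_wavePhase_add (h : IsPhaseMatrix Φ) (q ξ : Config n) :
    wavePhase α s t Φ (q - ξ) - wavePhase α s t Φ (q + ξ) =
      -2 * inner ℝ ξ (s + Matrix.toEuclideanCLM (𝕜 := ℝ) (reMat Φ) (q - t)) := by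
  have hquad := dotProduct_mulVec_sub_self_sub_add_self h.reMat_isSymm (q - t).ofLp ξ.ofLp
  rw [← WithLp.ofLp_add 2 (q - t), ← WithLp.ofLp_sub 2 (q - t), sub_add_eq_add_sub,
    sub_right_comm] at hquad
  rw [wavePhase, wavePhase, inner_add_left, inner_sub_left, inner_add_right,
    Matrix.inner_toEuclideanCLM]
  linear_combination (1 / 2 : ℝ) * hquad

theorem conj_gaussianWave_mul_gaussianWave (h : IsPhaseMatrix Φ) (q ξ : Config n) :
    starRingEnd ℂ (gaussianWave α s t Φ (q + ξ)) * gaussianWave α s t Φ (q - ξ) =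
      Real.exp (-((q - t).ofLp ⬝ᵥ imMat Φ *ᵥ (q - t).ofLp)) *
        (normalDensity 0 ((1 / 2 : ℝ) • (imMat Φ)⁻¹) ξ * Complex.exp (-2 * Complex.I *
          inner ℝ ξ (s + Matrix.toEuclideanCLM (𝕜 := ℝ) (reMat Φ) (q - t)))) := by
  have hphase := congrArg Complex.ofReal (wavePhase_sub_sub_wavePhase_add α s t h q ξ)
  have hmod := congrArg Complex.ofReal (sqrt_normalDensity_add_mul_sqrt_normalDensity_sub t
    ((1 / 2 : ℝ) • (imMat Φ)⁻¹) q ξ)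
  rw [inv_half_smul_inv h.isUnit_det_imMat, Matrix.smul_mulVec, dotProduct_smul,
    smul_eq_mul, ← mul_assoc, neg_mul, one_div_mul_cancel two_ne_zero, neg_one_mul] at hmod
  push_cast at hphase hmod
  rw [gaussianWave_eq α s t h, gaussianWave_eq α s t h, map_mul, Complex.conj_ofReal,
    ← Complex.exp_conj, map_mul, Complex.conj_I, Complex.conj_ofReal, mul_mul_mul_comm, hmod,
    ← Complex.exp_add]
  push_cast
  rw [mul_comm (Complex.exp _), mul_assoc]
  congr 3
  linear_combination Complex.I * hphase

theorem dotProduct_sigmaOf_mulVec (h : IsPhaseMatrix Φ) (a b : Fin n → ℝ) :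
    Sum.elim a b ⬝ᵥ sigmaOf Φ *ᵥ Sum.elim a b =
      a ⬝ᵥ imMat Φ *ᵥ a +
        (b - reMat Φ *ᵥ a) ⬝ᵥ (imMat Φ)⁻¹ *ᵥ (b - reMat Φ *ᵥ a) := by
  have hX : ∀ v w : Fin n → ℝ, (reMat Φ *ᵥ v) ⬝ᵥ w = v ⬝ᵥ reMat Φ *ᵥ w := fun v w => by
    rw [dotProduct_mulVec_comm_of_isSymm h.reMat_isSymm, dotProduct_comm]
  rw [sigmaOf, Matrix.fromBlocks_mulVec]
  simp only [Sum.elim_comp_inl, Sum.elim_comp_inr, sumElim_dotProduct_sumElim, Matrix.add_mulVec,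
    Matrix.neg_mulVec, Matrix.mulVec_sub, dotProduct_add, dotProduct_sub, dotProduct_neg,
    sub_dotProduct, hX, ← Matrix.mulVec_mulVec]
  ring

theorem wigner_gaussianWave (h : IsPhaseMatrix Φ) (u : Phase n) :
    wigner (gaussianWave α s t Φ) u = ((1 / Real.pi ^ n * Real.exp
      (-((u - column t s).ofLp ⬝ᵥ sigmaOf Φ *ᵥ (u - column t s).ofLp)) : ℝ) : ℂ) := by
  have hu : (u - column t s).ofLp = Sum.elim (upper u - t).ofLp (lower u - s).ofLp := by
    ext i
    cases i <;> rfl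
  set v := lower u - s - Matrix.toEuclideanCLM (𝕜 := ℝ) (reMat Φ) (upper u - t) with hv
  have hv' : v.ofLp = (lower u - s).ofLp - reMat Φ *ᵥ (upper u - t).ofLp := by
    rw [hv, WithLp.ofLp_sub, Matrix.ofLp_toEuclideanCLM]
  have hintegrand : ∀ ξ : Config n,
      starRingEnd ℂ (gaussianWave α s t Φ (upper u + ξ)) * gaussianWave α s t Φ (upper u - ξ) *
        Complex.exp (2 * Complex.I * ((∑ i, ξ i * lower u i : ℝ) : ℂ)) =
      Real.exp (-((upper u - t).ofLp ⬝ᵥ imMat Φ *ᵥ (upper u - t).ofLp)) *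
        (normalDensity 0 ((1 / 2 : ℝ) • (imMat Φ)⁻¹) ξ *
          Complex.exp (2 * Complex.I * inner ℝ ξ v)) := fun ξ => by
    have hinner : ∑ i, ξ i * lower u i = inner ℝ ξ (lower u) := by
      simp only [PiLp.inner_apply, RCLike.inner_apply, conj_trivial, mul_comm]
    rw [conj_gaussianWave_mul_gaussianWave α s t h, mul_assoc, mul_assoc, ← Complex.exp_add, hv,
      hinner, sub_sub, inner_sub_right]
    push_cast
    ring_nf
  rw [wigner, integral_congr_ae (.of_forall hintegrand), integral_const_mul,
    integral_normalDensity_mul_cexp h.2, hv', hu, dotProduct_sigmaOf_mulVec h, neg_add,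
    Real.exp_add]
  push_cast
  rfl

end WaveFunctions

section PhaseSpace

variable {n : ℕ}

theorem gaussianDensity_eq_normalDensity (S : Matrix (Fin n ⊕ Fin n) (Fin n ⊕ Fin n) ℝ)
    (m u : Phase n) : gaussianDensity S m u = normalDensity m S u := by
  rw [normalDensity, Fintype.card_sum, Fintype.card_fin, ← two_mul]
  rfl

theorem IsPure.gaussianDensity_eq {Δ : Matrix (Fin n ⊕ Fin n) (Fin n ⊕ Fin n) ℝ} (h : IsPure Δ)
    (m u : Phase n) :
    gaussianDensity ((1 / 2 : ℝ) • Δ⁻¹) m u =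
      1 / Real.pi ^ n * Real.exp (-((u - m).ofLp ⬝ᵥ Δ *ᵥ (u - m).ofLp)) := by
  rw [gaussianDensity_eq_normalDensity, normalDensity_half_smul_inv m h.posDef, h.2.1,
    Fintype.card_sum, Fintype.card_fin, pow_add, Real.sqrt_div zero_le_one, Real.sqrt_one,
    Real.sqrt_mul_self (by positivity)]

theorem isDensityOfGaussian_gaussianDensity {S : Matrix (Fin n ⊕ Fin n) (Fin n ⊕ Fin n) ℝ}
    (hS : S.PosDef) (m : Phase n) :
    IsDensityOfGaussian (fun u => (gaussianDensity S m u : ℂ)) S m := by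
  refine ⟨hS, fun _ => rfl, ?_⟩
  simp_rw [Complex.ofReal_re, gaussianDensity_eq_normalDensity]
  exact (multivariateGaussian_eq_withDensity m hS).symm

theorem IsDensityOfGaussian.unique {f : Phase n → ℂ}
    {S T : Matrix (Fin n ⊕ Fin n) (Fin n ⊕ Fin n) ℝ} {m k : Phase n}
    (hS : IsDensityOfGaussian f S m) (hT : IsDensityOfGaussian f T k) : S = T ∧ m = k :=
  Prod.mk.inj (multivariateGaussian_injOn (x₁ := (S, m)) (x₂ := (T, k)) hS.1.posSemidef
    hT.1.posSemidef (hS.2.2.symm.trans hT.2.2))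

theorem column_inj {q p q' p' : Config n} (h : column q p = column q' p') : q = q' ∧ p = p' :=
  ⟨congrArg upper h, congrArg lower h⟩

theorem column_upper_lower (u : Phase n) : column (upper u) (lower u) = u := by
  ext i
  cases i <;> rfl

theorem rescaledRotation_eq (u : Phase n) :
    rescaledRotation u = Matrix.toEuclideanCLM (𝕜 := ℝ) (√2 • Omega n) u := by
  have hu : u.ofLp = Sum.elim (upper u).ofLp (lower u).ofLp :=
    (congrArg WithLp.ofLp (column_upper_lower u)).symm
  ext i
  rw [Matrix.ofLp_toEuclideanCLM, Matrix.smul_mulVec, Omega, hu, Matrix.fromBlocks_mulVec]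
  cases i <;> simp [rescaledRotation, column, Matrix.neg_mulVec]

theorem IsPure.map_rescaledRotation {Δ : Matrix (Fin n ⊕ Fin n) (Fin n ⊕ Fin n) ℝ} (h : IsPure Δ)
    (m : Phase n) :
    (multivariateGaussian m ((1 / 2 : ℝ) • Δ⁻¹)).map rescaledRotation =
      multivariateGaussian (rescaledRotation m) Δ := by
  have hscale : √2 * (1 / 2 * √2) = 1 := by
    rw [mul_left_comm, Real.mul_self_sqrt zero_le_two, one_div_mul_cancel two_ne_zero]
  rw [show rescaledRotation = _ from funext rescaledRotation_eq,
    map_multivariateGaussian _ (half_smul_inv_posDef h.posDef).posSemidef, Matrix.transpose_smul]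
  simp only [Matrix.smul_mul, Matrix.mul_smul, smul_smul]
  rw [hscale, one_smul, h.Omega_mul_inv_mul_transpose]

end PhaseSpace

section GaussianStates

variable {n : ℕ} {ψ χ : L2 n} {s t : Config n} {Φ : Matrix (Fin n) (Fin n) ℂ}

theorem IsGaussianWith.wigner_eq (h : IsGaussianWith ψ s t Φ) (u : Phase n) :
    wigner ψ u = ((1 / Real.pi ^ n * Real.exp
      (-((u - column t s).ofLp ⬝ᵥ sigmaOf Φ *ᵥ (u - column t s).ofLp)) : ℝ) : ℂ) := by
  obtain ⟨hΦ, α, -, hψ⟩ := h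
  rw [wigner_congr_ae hψ, wigner_gaussianWave α s t hΦ]

theorem IsGaussianWith.isDensityOfGaussian (h : IsGaussianWith ψ s t Φ) :
    IsDensityOfGaussian (wigner ψ) ((1 / 2 : ℝ) • (sigmaOf Φ)⁻¹) (column t s) := by
  have hpure := h.1.isPure_sigmaOf
  have hψ : wigner ψ = fun u =>
      (gaussianDensity ((1 / 2 : ℝ) • (sigmaOf Φ)⁻¹) (column t s) u : ℂ) :=
    funext fun u => by rw [h.wigner_eq, hpure.gaussianDensity_eq]
  exact hψ ▸ isDensityOfGaussian_gaussianDensity (half_smul_inv_posDef hpure.posDef) _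

theorem IsGaussianWith.map_rescaledRotation (h : IsGaussianWith ψ s t Φ) :
    (volume.withDensity fun u => ENNReal.ofReal (wigner ψ u).re).map rescaledRotation =
      multivariateGaussian (column (√2 • s) (-(√2 • t))) (sigmaOf Φ) := by
  rw [h.isDensityOfGaussian.2.2, h.1.isPure_sigmaOf.map_rescaledRotation]
  rfl

theorem isDensityOfGaussian_wigner_iff (ψ : GaussianState n) (hΦ : IsPhaseMatrix Φ) :
    IsDensityOfGaussian (wigner ψ.1) ((1 / 2 : ℝ) • (sigmaOf Φ)⁻¹) (column t s) ↔
      IsGaussianWith ψ.1 s t Φ := by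
  refine ⟨fun hd => ?_, fun h => h.isDensityOfGaussian⟩
  obtain ⟨ψ, s', t', Ψ, h⟩ := ψ
  obtain ⟨hcov, hmean⟩ := h.isDensityOfGaussian.unique hd
  have hσ := half_smul_inv_injOn h.1.isPure_sigmaOf.isUnit_det hΦ.isPure_sigmaOf.isUnit_det hcov
  obtain rfl := sigmaOf_injOn h.1 hΦ hσ
  obtain ⟨rfl, rfl⟩ := column_inj hmean
  exact h

theorem exists_isGaussianWith (s t : Config n) (h : IsPhaseMatrix Φ) :
    ∃ ψ : L2 n, IsGaussianWith ψ s t Φ :=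
  ⟨(memLp_gaussianWave 0 s t h).toLp _, h, 0, ⟨le_rfl, Real.two_pi_pos⟩, MemLp.coeFn_toLp _⟩

theorem IsGaussianWith.exists_phase (hψ : IsGaussianWith ψ s t Φ) (hχ : IsGaussianWith χ s t Φ) :
    ∃ θ : ℝ, χ = Complex.exp (Complex.I * θ) • ψ := by
  obtain ⟨-, α, -, hα⟩ := hψ
  obtain ⟨-, β, -, hβ⟩ := hχ
  refine ⟨β - α, Lp.ext ?_⟩
  filter_upwards [hα, hβ, Lp.coeFn_smul (Complex.exp (Complex.I * ((β - α : ℝ) : ℂ))) ψ]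
    with x hψx hχx hsmul
  rw [hsmul, hχx, Pi.smul_apply, hψx, smul_eq_mul, ← gaussianWave_phase, sub_add_cancel]

theorem exists_isDensityOfGaussian_wignerRay (x : Quotient (phaseSetoid n)) :
    ∃ (Δ : Matrix (Fin n ⊕ Fin n) (Fin n ⊕ Fin n) ℝ) (m : Phase n),
      IsPure Δ ∧ IsDensityOfGaussian (wignerRay n x) ((1 / 2 : ℝ) • Δ⁻¹) m := by
  obtain ⟨⟨ψ, s, t, Φ, h⟩, rfl⟩ := Quotient.exists_rep x
  exact ⟨sigmaOf Φ, column t s, h.1.isPure_sigmaOf, h.isDensityOfGaussian⟩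

theorem wignerRay_injective : Function.Injective (wignerRay n) := by
  refine Quotient.ind₂ fun ψ χ (h : wigner ψ.1 = wigner χ.1) => Quotient.sound ?_
  obtain ⟨s, t, Φ, hχ⟩ := χ.2
  have hψ := (isDensityOfGaussian_wigner_iff ψ hχ.1).mp (h ▸ hχ.isDensityOfGaussian)
  exact hψ.exists_phase hχ

theorem exists_wignerRay_eq {Δ : Matrix (Fin n ⊕ Fin n) (Fin n ⊕ Fin n) ℝ} (hΔ : IsPure Δ)
    {W : Phase n → ℂ} {m : Phase n} (hW : IsDensityOfGaussian W ((1 / 2 : ℝ) • Δ⁻¹) m) :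
    ∃ x, wignerRay n x = W := by
  obtain ⟨A, B, C, rfl⟩ := exists_eq_fromBlocks_of_isSymm hΔ.1
  obtain ⟨ψ, hψ⟩ := exists_isGaussianWith (lower m) (upper m) hΔ.isPhaseMatrix_phaseOf
  have hd := hψ.isDensityOfGaussian
  rw [hΔ.sigmaOf_phaseOf, column_upper_lower] at hd
  exact ⟨Quotient.mk _ ⟨ψ, _, _, _, hψ⟩, funext fun u => (hd.2.1 u).trans (hW.2.1 u).symm⟩

end GaussianStates

end GaussWigner

open GaussWigner in
theorem mainTheorem7 (n : ℕ) :
    -- every admissible choice of parameters defines a Gaussian state in `L²(ℝⁿ)`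
    (∀ (α : ℝ) (s t : Config n) (Φ : Matrix (Fin n) (Fin n) ℂ), IsPhaseMatrix Φ →
      MeasureTheory.MemLp (gaussianWave α s t Φ) 2 MeasureTheory.volume) ∧
    -- the Wigner transform of a Gaussian state
    (∀ (ψ : L2 n) (s t : Config n) (Φ : Matrix (Fin n) (Fin n) ℂ), IsGaussianWith ψ s t Φ →
      IsPure (sigmaOf Φ) ∧
      (∀ u : Phase n, wigner ψ u = ((1 / Real.pi ^ n * Real.exp
        (-((fun i => u i - column t s i) ⬝ᵥ sigmaOf Φ *ᵥ (fun i => u i - column t s i))) : ℝ) : ℂ)) ∧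
      IsDensityOfGaussian (wigner ψ) ((1 / 2 : ℝ) • (sigmaOf Φ)⁻¹) (column t s) ∧
      (MeasureTheory.volume.withDensity (fun u => ENNReal.ofReal (wigner ψ u).re)).map
          rescaledRotation =
        ProbabilityTheory.multivariateGaussian
          (column (Real.sqrt 2 • s) (-(Real.sqrt 2 • t))) (sigmaOf Φ)) ∧
    -- the converse, with an explicit phase matrix
    (∀ A B C : Matrix (Fin n) (Fin n) ℝ, A.IsSymm → C.IsSymm →
      IsPure (Matrix.fromBlocks A B Bᵀ C) →
      IsUnit C.det ∧ IsPhaseMatrix (phaseOf B C) ∧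
      sigmaOf (phaseOf B C) = Matrix.fromBlocks A B Bᵀ C ∧
      ∀ (s t : Config n) (ψ : GaussianState n),
        IsDensityOfGaussian (wigner ψ.1)
            ((1 / 2 : ℝ) • (Matrix.fromBlocks A B Bᵀ C)⁻¹) (column t s) ↔
          IsGaussianWith ψ.1 s t (phaseOf B C)) ∧
    -- distinct parameters give distinct Gaussian distributions
    Set.InjOn (fun x : Matrix (Fin n ⊕ Fin n) (Fin n ⊕ Fin n) ℝ × Phase n =>
        ProbabilityTheory.multivariateGaussian x.2 ((1 / 2 : ℝ) • x.1⁻¹)) {x | IsPure x.1} ∧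
    -- the Wigner transform is a bijection from Gaussian states modulo global phase
    Set.BijOn (wignerRay n) Set.univ
      {W | ∃ (Δ : Matrix (Fin n ⊕ Fin n) (Fin n ⊕ Fin n) ℝ) (m : Phase n),
        IsPure Δ ∧ IsDensityOfGaussian W ((1 / 2 : ℝ) • Δ⁻¹) m} := by
  refine ⟨fun α s t Φ h => memLp_gaussianWave α s t h, fun ψ s t Φ h => ?_, fun A B C _ _ h => ?_,
    multivariateGaussian_half_smul_inv_injOn.mono fun x hx => IsPure.posDef hx, ?_⟩
  · exact ⟨h.1.isPure_sigmaOf, h.wigner_eq, h.isDensityOfGaussian, h.map_rescaledRotation⟩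
  · have hC : C.PosDef := (isPure_fromBlocks_iff.mp h).1
    have hσ := h.sigmaOf_phaseOf
    refine ⟨hC.det_pos.ne'.isUnit, h.isPhaseMatrix_phaseOf, hσ, fun s t ψ => ?_⟩
    rw [← hσ, isDensityOfGaussian_wigner_iff ψ h.isPhaseMatrix_phaseOf]
  · refine ⟨fun x _ => exists_isDensityOfGaussian_wignerRay x, wignerRay_injective.injOn, ?_⟩
    rintro W ⟨Δ, m, hΔ, hW⟩
    obtain ⟨x, hx⟩ := exists_wignerRay_eq hΔ hW
    exact ⟨x, Set.mem_univ x, hx⟩
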